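/- For a real number $x$ let $(x)_k = x(x+1)\cdots(x+k-1)$, and let $$P_n^{(\alpha,\beta)}(x)=\frac{(\alpha+1)_n}{n!}\sum_{k=0}^{n}\frac{(-n)_k\,(n+\alpha+\beta+1)_k}{k!\,(\alpha+1)_k}\left(\frac{1-x}{2}\right)^k$$ be the Jacobi polynomials. Put $$\phi_n^{(\alpha,\beta)}(\mu)=\sum_{k=0}^{\lfloor n/2\rfloor}\left.\frac{d^{2k}}{dx^{2k}}P_n^{(\alpha,\beta)}(x)\right|_{x=1}\mu^k .$$ Two real polynomials $g$ and $h$ are said to interlace if all complex zeros of $g$ and of $h$ are real and simple, $g$ and $h$ have no common zero, between each two consecutive zeros of $g$ there is exactly one zero of $h$, and between each two consecutive zeros of $h$ there is exactly one zero of $g$. Let $\alpha,\beta$ be real numbers with either $-1<\alpha<1$ and $\beta>0$, or $1\le\alpha<2$ and $\beta>1$, and let $n\ge 4$ be an integer. Then the polynomials $\phi_n^{(\alpha,\beta)}(\mu)$ and $\phi_{n-1}^{(\alpha,\beta)}(\mu)$ interlace. Furthermore, the polynomials $\phi_n^{(\alpha,\beta)}(\mu)$ and $\mu\,\phi_{n-1}^{(\alpha,\beta)}(\mu)$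 interlace. -/

import Mathlib

open Polynomial

noncomputable section

/-- The rising factorial `(x)_k = x (x + 1) ⋯ (x + k - 1)` of a real number. -/
def risingFactorial (x : ℝ) (k : ℕ) : ℝ := (ascPochhammer ℝ k).eval x

/-- The Jacobi polynomial `P_n^{(α,β)}`, given by the terminating hypergeometric series
`((α+1)_n / n!) ∑_k (-n)_k (n+α+β+1)_k / (k! (α+1)_k) ((1-x)/2)^k`
(the terms with `k > n` vanish because of the factor `(-n)_k`). -/
def jacobiPoly (α β : ℝ) (n : ℕ) : ℝ[X] :=
  C (risingFactorial (α + 1) n / (n.factorial : ℝ)) *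
    ∑ k ∈ Finset.range (n + 1),
      C (risingFactorial (-(n : ℝ)) k * risingFactorial ((n : ℝ) + α + β + 1) k /
          ((k.factorial : ℝ) * risingFactorial (α + 1) k)) *
        (C (1 / 2 : ℝ) * (1 - X)) ^ k

/-- The polynomial `φ_n^{(α,β)}(μ) = ∑_{k=0}^{⌊n/2⌋} (d^{2k}/dx^{2k} P_n^{(α,β)})(1) μ^k`. -/
def jacobiPhi (α β : ℝ) (n : ℕ) : ℝ[X] :=
  ∑ k ∈ Finset.range (n / 2 + 1),
    C ((derivative^[2 * k] (jacobiPoly α β n)).eval 1) * X ^ k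

/-- All complex zeros of the real polynomial `p` are real and simple. -/
def HasSimpleRealZeros (p : ℝ[X]) : Prop :=
  ∀ z : ℂ, aeval z p = 0 →
    z.im = 0 ∧ (p.map (algebraMap ℝ ℂ)).rootMultiplicity z = 1

/-- Between each two consecutive real zeros of `g` there is exactly one zero of `h`. -/
def OneZeroBetweenConsecutive (g h : ℝ[X]) : Prop :=
  ∀ a b : ℝ, a < b → g.eval a = 0 → g.eval b = 0 →
    (∀ c ∈ Set.Ioo a b, g.eval c ≠ 0) →
    ∃! c : ℝ, c ∈ Set.Ioo a b ∧ h.eval c = 0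

/-- Strict interlacing of the zeros of two real polynomials. -/
structure Interlace (g h : ℝ[X]) : Prop where
  left_zeros : HasSimpleRealZeros g
  right_zeros : HasSimpleRealZeros h
  no_common_zero : ∀ z : ℂ, aeval z g = 0 → aeval z h ≠ 0
  between_left : OneZeroBetweenConsecutive g h
  between_right : OneZeroBetweenConsecutive h g

end

noncomputable section

/-! ### Interlacing from sign conditions at the zeros -/

/-! Put `F_n(μ) = ∑ₖ P_n^{(k)}(1) μ^k = φ_n(μ²) + μ ψ_n(μ²)` (`jacobiGen`, with `ψ_n` =
`jacobiPsi`). Suppose `-1 < α < 1` and `β > 0`. Everything rests on one stability statement,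
`jacobiGen_add_mul_ne_zero`: `F_{m+1}(μ) + s F_m(μ)` has no zero with `μ ≠ 0`, `Re μ ≥ 0`, `Re (s/μ)
≥ 0`.

To see this, use `t = (1-x)/2`, `T_n(t) = P_n(1-2t)`, `ν = μ/2`. The value in question is `r(0)`,
where `r` is the polynomial solution of `r + ν r' = T_{m+1} + s T_m`. If it vanished, then `r = t
q`. Integrate the equation against `q̄` and the weight `t^α (1-t)^β`, and divide by `ν`.
Orthogonality removes `T_{m+1}` and evaluates the `T_m` term, leaving `A/ν + B + ρ s/ν = 0` with `A,
ρ > 0`. An integration by parts (`jacobiIntegral_energy_pos`) gives `Re B > 0`, so the real parts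
cannot sum to zero.

Taking `s = 0` shows that `F_n` is Hurwitz. By Hermite–Biehler the zeros of `φ_n` and `ψ_n` are then
negative, with known signs of `φ_n' ψ_n` and `ψ_n' φ_n` at them. Taking `μ` imaginary and `s =
-F_{m+1}/F_m` gives `ψ_{m+1} φ_m - φ_{m+1} ψ_m > 0` on the negative axis. Combined, these fix the
sign of `φ_{m+1}' φ_m` at the zeros of `φ_{m+1}` and of `φ_m' φ_{m+1}` at the zeros of `φ_m`, which
forces interlacing; the same works for `ψ`.

For `1 ≤ α < 2`, `β > 1`, the derivative formula for Jacobi polynomials makes `φ_n^{(α,β)}` a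
nonzero multiple of `ψ_{n+1}^{(α-1,β-1)}`, and the shifted parameters lie in the first range. -/

theorem aeval_ofReal_complex (p : ℝ[X]) (x : ℝ) : aeval (x : ℂ) p = ((p.eval x : ℝ) : ℂ) := by
  simpa using (aeval_algebraMap_apply_eq_algebraMap_eval (A := ℂ) x p)

theorem Interlace.symm {g h : ℝ[X]} (H : Interlace g h) : Interlace h g where
  left_zeros := H.right_zeros
  right_zeros := H.left_zeros
  no_common_zero z hh hg := H.no_common_zero z hg hh
  between_left := H.between_right
  between_right := H.between_left

theorem hasSimpleRealZeros_of_derivative_ne_zero {p : ℝ[X]}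
    (hre : ∀ z : ℂ, aeval z p = 0 → z.im = 0)
    (hder : ∀ x : ℝ, p.eval x = 0 → (derivative p).eval x ≠ 0) : HasSimpleRealZeros p := by
  intro z hz
  have him := hre z hz
  refine ⟨him, ?_⟩
  obtain ⟨x, rfl⟩ : ∃ x : ℝ, z = x := ⟨z.re, by apply Complex.ext <;> simp [him]⟩
  rw [aeval_ofReal_complex] at hz
  have hx : p.eval x = 0 := by exact_mod_cast hz
  have hd := hder x hx
  have hp : p ≠ 0 := by rintro rfl; simp at hd
  have hmap : p.map (algebraMap ℝ ℂ) ≠ 0 :=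
    (Polynomial.map_ne_zero_iff (algebraMap ℝ ℂ).injective).2 hp
  have h1 : 0 < (p.map (algebraMap ℝ ℂ)).rootMultiplicity (x : ℂ) := by
    rw [rootMultiplicity_pos hmap, IsRoot, eval_map_algebraMap, aeval_ofReal_complex, hx]
    simp
  have h2 : ¬ 1 < (p.map (algebraMap ℝ ℂ)).rootMultiplicity (x : ℂ) := by
    rw [one_lt_rootMultiplicity_iff_isRoot hmap]
    rintro ⟨-, h⟩
    rw [IsRoot, derivative_map, eval_map_algebraMap, aeval_ofReal_complex] at h
    exact hd (by exact_mod_cast h)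
  omega

/-- A real polynomial with positive slope at two zeros has a zero in between. -/
theorem exists_zero_between_of_derivative_pos {g : ℝ[X]} {a b : ℝ} (hab : a < b)
    (ha : g.eval a = 0) (hb : g.eval b = 0) (hda : 0 < (derivative g).eval a)
    (hdb : 0 < (derivative g).eval b) : ∃ c ∈ Set.Ioo a b, g.eval c = 0 := by
  have ea := eventually_nhdsWithin_sign_eq_of_deriv_pos (f := fun x => g.eval x) (x₀ := a)
    (by simpa using hda) ha
  have eb := eventually_nhdsWithin_sign_eq_of_deriv_pos (f := fun x => g.eval x) (x₀ := b)
    (by simpa using hdb) hb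
  obtain ⟨x, ⟨hx, hxm⟩⟩ := ((ea.filter_mono nhdsWithin_le_nhds).and
    (Ioo_mem_nhdsGT (show a < (a + b) / 2 by linarith))).exists
  obtain ⟨y, ⟨hy, hym⟩⟩ := ((eb.filter_mono nhdsWithin_le_nhds).and
    (Ioo_mem_nhdsLT (show (a + b) / 2 < b by linarith))).exists
  rw [sign_pos (sub_pos.2 hxm.1), sign_eq_one_iff] at hx
  rw [sign_neg (sub_neg.2 hym.2), sign_eq_neg_one_iff] at hy
  have hxy : x ≤ y := (hxm.2.trans hym.1).le
  obtain ⟨c, hc, hc0⟩ := intermediate_value_Icc' hxy g.continuous.continuousOn ⟨hy.le, hx.le⟩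
  exact ⟨c, ⟨hxm.1.trans_le hc.1, hc.2.trans_lt hym.2⟩, hc0⟩

theorem exists_zero_between_of_derivative_mul_pos {g : ℝ[X]} {a b : ℝ} (hab : a < b)
    (ha : g.eval a = 0) (hb : g.eval b = 0)
    (hd : 0 < (derivative g).eval a * (derivative g).eval b) :
    ∃ c ∈ Set.Ioo a b, g.eval c = 0 := by
  rcases mul_pos_iff.1 hd with ⟨h1, h2⟩ | ⟨h1, h2⟩
  · exact exists_zero_between_of_derivative_pos hab ha hb h1 h2
  · obtain ⟨c, hc, h⟩ := exists_zero_between_of_derivative_pos (g := -g) hab (by simpa)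
      (by simpa) (by simpa) (by simpa)
    exact ⟨c, hc, by simpa using h⟩

/-- If `g' h` has a constant sign on the zeros of `g`, then `h` vanishes between any two zeros
of `g`. -/
theorem exists_zero_between {g h : ℝ[X]} {ε : ℝ}
    (H : ∀ x, g.eval x = 0 → 0 < ε * ((derivative g).eval x * h.eval x)) {a b : ℝ} (hab : a < b)
    (ha : g.eval a = 0) (hb : g.eval b = 0) : ∃ c ∈ Set.Ioo a b, h.eval c = 0 := by
  classical
  have hg : g ≠ 0 := by rintro rfl; simpa using H a ha
  -- The least element `m` of `S` is the zero of `g` following `a`; simple consecutive zeros have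
  -- slopes of opposite sign, so `h` must change sign on `(a, m)`.
  set S := g.roots.toFinset.filter (fun x => x ∈ Set.Ioc a b) with hS
  have hmem : ∀ x, x ∈ S ↔ g.eval x = 0 ∧ x ∈ Set.Ioc a b := by
    intro x; simp [hS, hg]
  have hne : S.Nonempty := ⟨b, (hmem b).2 ⟨hb, hab, le_rfl⟩⟩
  obtain ⟨hm0, hma, hmb⟩ := (hmem _).1 (S.min'_mem hne)
  set m := S.min' hne with hm
  have hno : ¬ ∃ c ∈ Set.Ioo a m, g.eval c = 0 := by
    rintro ⟨c, hc, hc0⟩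
    have := S.min'_le c ((hmem c).2 ⟨hc0, hc.1, hc.2.le.trans hmb⟩)
    exact absurd hc.2 (not_lt.2 this)
  have hd : (derivative g).eval a * (derivative g).eval m ≤ 0 := by
    by_contra hcon
    exact hno (exists_zero_between_of_derivative_mul_pos hma ha hm0 (not_le.1 hcon))
  have h1 := H a ha
  have h2 := H m hm0
  have hprod : h.eval a * h.eval m < 0 := by
    by_contra hcon
    have h3 := mul_pos h1 h2
    have h4 := mul_nonneg (sq_nonneg ε) (not_lt.1 hcon)
    nlinarith [mul_nonneg h4 (neg_nonneg.2 hd)]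
  have hc : ContinuousOn (fun x => h.eval x) (Set.Icc a m) := h.continuous.continuousOn
  rcases mul_neg_iff.1 hprod with ⟨p1, p2⟩ | ⟨p1, p2⟩
  · obtain ⟨c, hc, hc0⟩ := intermediate_value_Ioo' hma.le hc ⟨p2, p1⟩
    exact ⟨c, ⟨hc.1, hc.2.trans_le hmb⟩, hc0⟩
  · obtain ⟨c, hc, hc0⟩ := intermediate_value_Ioo hma.le hc ⟨p1, p2⟩
    exact ⟨c, ⟨hc.1, hc.2.trans_le hmb⟩, hc0⟩

/-- Existence comes from the sign condition at the zeros of `g`. Uniqueness comes from the other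
one: two zeros of `h` in the gap would enclose a further zero of `g`. -/
theorem oneZeroBetweenConsecutive_of_sign {g h : ℝ[X]} {ε δ : ℝ}
    (hgh : ∀ x, g.eval x = 0 → 0 < ε * ((derivative g).eval x * h.eval x))
    (hhg : ∀ x, h.eval x = 0 → 0 < δ * ((derivative h).eval x * g.eval x)) :
    OneZeroBetweenConsecutive g h := by
  intro a b hab ha hb hno
  obtain ⟨c, hc, hc0⟩ := exists_zero_between hgh hab ha hb
  refine ⟨c, ⟨hc, hc0⟩, ?_⟩
  rintro d ⟨hd, hd0⟩
  by_contra hne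
  rcases lt_or_gt_of_ne hne with hlt | hlt
  · obtain ⟨e, he, he0⟩ := exists_zero_between hhg hlt hd0 hc0
    exact hno e ⟨hd.1.trans he.1, he.2.trans hc.2⟩ he0
  · obtain ⟨e, he, he0⟩ := exists_zero_between hhg hlt hc0 hd0
    exact hno e ⟨hc.1.trans he.1, he.2.trans hd.2⟩ he0

/-- Real-rooted polynomials `g`, `h` with `g' h > 0` on the zeros of `g` and `h' g < 0` on the
zeros of `h` interlace. -/
theorem interlace_of_sign {g h : ℝ[X]}
    (hg : ∀ z : ℂ, aeval z g = 0 → z.im = 0) (hh : ∀ z : ℂ, aeval z h = 0 → z.im = 0)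
    (hgh : ∀ x : ℝ, g.eval x = 0 → 0 < (derivative g).eval x * h.eval x)
    (hhg : ∀ x : ℝ, h.eval x = 0 → (derivative h).eval x * g.eval x < 0) : Interlace g h where
  left_zeros := hasSimpleRealZeros_of_derivative_ne_zero hg
    fun x hx h0 => by simpa [h0] using hgh x hx
  right_zeros := hasSimpleRealZeros_of_derivative_ne_zero hh
    fun x hx h0 => by simpa [h0] using hhg x hx
  no_common_zero z hz hz' := by
    obtain ⟨x, rfl⟩ : ∃ x : ℝ, z = x := ⟨z.re, by apply Complex.ext <;> simp [hg z hz]⟩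
    rw [aeval_ofReal_complex] at hz hz'
    have h1 : g.eval x = 0 := by exact_mod_cast hz
    have h2 : h.eval x = 0 := by exact_mod_cast hz'
    simpa [h2] using hgh x h1
  between_left := oneZeroBetweenConsecutive_of_sign (ε := 1) (δ := -1)
    (by simpa using hgh) (by simpa using hhg)
  between_right := oneZeroBetweenConsecutive_of_sign (ε := -1) (δ := 1)
    (by simpa using hhg) (by simpa using hgh)

/-- If all zeros of `g` and `h` are negative, `g' h > 0` on the zeros of `g`, `h' g < 0` on the
zeros of `h`, and `g`, `h` have the same sign at `0`, then `g` interlaces with `h` and `X h`. -/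
theorem interlace_and_interlace_X_mul {g h : ℝ[X]}
    (hg : ∀ z : ℂ, aeval z g = 0 → z.im = 0 ∧ z.re < 0)
    (hh : ∀ z : ℂ, aeval z h = 0 → z.im = 0 ∧ z.re < 0)
    (hgh : ∀ x : ℝ, x < 0 → g.eval x = 0 → 0 < (derivative g).eval x * h.eval x)
    (hhg : ∀ x : ℝ, x < 0 → h.eval x = 0 → (derivative h).eval x * g.eval x < 0)
    (h0 : 0 < h.eval 0 * g.eval 0) : Interlace g h ∧ Interlace g (X * h) := by
  have ng : ∀ x : ℝ, g.eval x = 0 → x < 0 := fun x hx => by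
    simpa using (hg x (by rw [aeval_ofReal_complex, hx]; simp)).2
  have nh : ∀ x : ℝ, h.eval x = 0 → x < 0 := fun x hx => by
    simpa using (hh x (by rw [aeval_ofReal_complex, hx]; simp)).2
  refine ⟨interlace_of_sign (fun z hz => (hg z hz).1) (fun z hz => (hh z hz).1)
    (fun x hx => hgh x (ng x hx) hx) (fun x hx => hhg x (nh x hx) hx), Interlace.symm ?_⟩
  -- The roles are exchanged because the factor `X` is negative at all the zeros except the new one
  -- at `0`, where the slope of `X * h` is `h(0)`.
  refine interlace_of_sign ?_ (fun z hz => (hg z hz).1) ?_ ?_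
  · intro z hz
    rw [map_mul, aeval_X] at hz
    rcases mul_eq_zero.1 hz with rfl | hz
    · simp
    · exact (hh z hz).1
  · intro x hx
    rw [eval_mul, eval_X] at hx
    rcases mul_eq_zero.1 hx with rfl | hx
    · simpa [derivative_mul] using h0
    · have := mul_pos_of_neg_of_neg (nh x hx) (hhg x (nh x hx) hx)
      simpa [derivative_mul, hx, mul_assoc] using this
  · intro x hx
    have := mul_neg_of_neg_of_pos (ng x hx) (hgh x (ng x hx) hx)
    simp only [eval_mul, eval_X]
    linarith [mul_left_comm x ((derivative g).eval x) (h.eval x)]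

/-! ### The Hermite–Biehler theorem for stable real polynomials -/

/-- Reflecting a point of the right half-plane in the imaginary axis brings it closer to every root
on the left. The weak inequality is carried along because the empty product gives equality. -/
theorem norm_prod_neg_conj_sub_le {μ : ℂ} (hμ : 0 < μ.re) (s : Multiset ℂ)
    (hs : ∀ a ∈ s, a.re < 0) :
    ‖(s.map fun a => -(starRingEnd ℂ μ) - a).prod‖ ≤ ‖(s.map fun a => μ - a).prod‖ ∧
      (s ≠ 0 → ‖(s.map fun a => -(starRingEnd ℂ μ) - a).prod‖ <
        ‖(s.map fun a => μ - a).prod‖) := by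
  induction s using Multiset.induction_on with
  | empty => simp
  | cons a s ih =>
    have ih' := (ih fun b hb => hs b (Multiset.mem_cons_of_mem hb)).1
    have ha : a.re < 0 := hs a (Multiset.mem_cons_self a s)
    have hlt : ‖-(starRingEnd ℂ μ) - a‖ < ‖μ - a‖ := by
      rw [← sq_lt_sq₀ (norm_nonneg _) (norm_nonneg _), ← Complex.normSq_eq_norm_sq,
        ← Complex.normSq_eq_norm_sq, Complex.normSq_apply, Complex.normSq_apply]
      simp
      nlinarith [mul_pos hμ (neg_pos.2 ha)]
    have hpos : 0 < ‖(s.map fun a => μ - a).prod‖ := by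
      rw [norm_pos_iff]
      intro h0
      obtain ⟨b, hb, hb0⟩ := Multiset.mem_map.1 (Multiset.prod_eq_zero_iff.1 h0)
      have := hs b (Multiset.mem_cons_of_mem hb)
      have e : μ = b := sub_eq_zero.1 hb0
      rw [e] at hμ
      linarith
    have key : ‖((a ::ₘ s).map fun a => -(starRingEnd ℂ μ) - a).prod‖ <
        ‖((a ::ₘ s).map fun a => μ - a).prod‖ := by
      simp only [Multiset.map_cons, Multiset.prod_cons, norm_mul]
      exact (mul_le_mul_of_nonneg_left ih' (norm_nonneg _)).trans_lt
        (mul_lt_mul_of_pos_right hlt hpos)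
    exact ⟨key.le, fun _ => key⟩

/-- A real polynomial all of whose complex zeros have negative real part. -/
def IsHurwitz (F : ℝ[X]) : Prop := ∀ z : ℂ, 0 ≤ z.re → aeval z F ≠ 0

theorem IsHurwitz.ne_zero {F : ℝ[X]} (hF : IsHurwitz F) : F ≠ 0 := by
  rintro rfl
  exact hF 0 le_rfl (by simp)

theorem IsHurwitz.roots_re_neg {F : ℝ[X]} (hF : IsHurwitz F) {a : ℂ}
    (ha : a ∈ (F.map (algebraMap ℝ ℂ)).roots) : a.re < 0 := by
  by_contra h
  apply hF a (not_lt.1 h)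
  have := (mem_roots'.1 ha).2
  rwa [IsRoot, eval_map_algebraMap] at this

theorem IsHurwitz.roots_ne_zero {F : ℝ[X]} (hdeg : 0 < F.natDegree) :
    (F.map (algebraMap ℝ ℂ)).roots ≠ 0 := by
  intro h
  have := (IsAlgClosed.splits (F.map (algebraMap ℝ ℂ))).natDegree_eq_card_roots
  rw [h, natDegree_map] at this
  simp at this
  omega

theorem aeval_conj_real (F : ℝ[X]) (z : ℂ) :
    aeval (starRingEnd ℂ z) F = starRingEnd ℂ (aeval z F) := by
  rw [aeval_def, aeval_def, hom_eval₂]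
  congr 1
  ext x
  simp

/-- Real coefficients allow `-μ` to be replaced by `-μ̄`, the mirror image of `μ` in the imaginary
axis; then compare factor by factor. -/
theorem IsHurwitz.norm_aeval_neg_lt {F : ℝ[X]} (hF : IsHurwitz F) (hdeg : 0 < F.natDegree)
    {μ : ℂ} (hμ : 0 < μ.re) : ‖aeval (-μ) F‖ < ‖aeval μ F‖ := by
  have h1 : ‖aeval (-μ) F‖ = ‖aeval (-(starRingEnd ℂ μ)) F‖ := by
    rw [← map_neg, aeval_conj_real, RCLike.norm_conj]
  have hsp := IsAlgClosed.splits (F.map (algebraMap ℝ ℂ))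
  have hev : ∀ z : ℂ, aeval z F = (F.map (algebraMap ℝ ℂ)).leadingCoeff *
      ((F.map (algebraMap ℝ ℂ)).roots.map fun a => z - a).prod := fun z => by
    rw [← hsp.eval_eq_prod_roots, eval_map_algebraMap]
  rw [h1, hev, hev, norm_mul, norm_mul]
  refine mul_lt_mul_of_pos_left ((norm_prod_neg_conj_sub_le hμ _
    fun a ha => hF.roots_re_neg ha).2 (IsHurwitz.roots_ne_zero hdeg)) ?_
  rw [norm_pos_iff, Ne, leadingCoeff_eq_zero]
  exact (Polynomial.map_ne_zero_iff (algebraMap ℝ ℂ).injective).2 hF.ne_zero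

/-- On the imaginary axis the argument of a Hurwitz polynomial is strictly increasing. -/
theorem IsHurwitz.re_derivative_div_pos {F : ℝ[X]} (hF : IsHurwitz F) (hdeg : 0 < F.natDegree)
    {z : ℂ} (hz : z.re = 0) : 0 < (aeval z (derivative F) / aeval z F).re := by
  have hsp := IsAlgClosed.splits (F.map (algebraMap ℝ ℂ))
  have hne : (F.map (algebraMap ℝ ℂ)).eval z ≠ 0 := by
    rw [eval_map_algebraMap]
    exact hF z hz.ge
  have h := hsp.eval_derivative_div_eval_of_ne_zero hne
  rw [derivative_map, eval_map_algebraMap, eval_map_algebraMap] at h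
  rw [h]
  have hs := fun a ha => hF.roots_re_neg (a := a) ha
  have hn := IsHurwitz.roots_ne_zero hdeg
  have hpos : ∀ a : ℂ, a.re < 0 → 0 < (1 / (z - a)).re := fun a ha => by
    rw [one_div, Complex.inv_re]
    have hre : 0 < (z - a).re := by simp [hz, ha]
    refine div_pos hre (Complex.normSq_pos.2 fun h0 => ?_)
    rw [h0] at hre
    simp at hre
  generalize (F.map (algebraMap ℝ ℂ)).roots = s at hs hn
  have hnn : ∀ s : Multiset ℂ, (∀ a ∈ s, a.re < 0) →
      0 ≤ ((s.map fun a => 1 / (z - a)).sum).re := by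
    intro s
    induction s using Multiset.induction_on with
    | empty => simp
    | cons a s ih =>
      intro hs
      rw [Multiset.map_cons, Multiset.sum_cons, Complex.add_re]
      exact add_nonneg (hpos a (hs a (Multiset.mem_cons_self a s))).le
        (ih fun b hb => hs b (Multiset.mem_cons_of_mem hb))
  obtain ⟨a, ha⟩ := Multiset.exists_mem_of_ne_zero hn
  obtain ⟨t, rfl⟩ := Multiset.exists_cons_of_mem ha
  rw [Multiset.map_cons, Multiset.sum_cons, Complex.add_re]
  exact add_pos_of_pos_of_nonneg (hpos a (hs a ha))
    (hnn t fun b hb => hs b (Multiset.mem_cons_of_mem hb))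

theorem exists_sq_eq_re_nonneg (z : ℂ) : ∃ μ : ℂ, μ ^ 2 = z ∧ 0 ≤ μ.re := by
  obtain ⟨μ, hμ⟩ := IsAlgClosed.exists_pow_nat_eq z (n := 2) two_pos
  rcases le_total 0 μ.re with h | h
  · exact ⟨μ, hμ, h⟩
  · exact ⟨-μ, by rw [neg_sq, hμ], by simpa using h⟩

section HermiteBiehler

variable {F E O : ℝ[X]}

theorem aeval_even_add_odd (hsplit : F = E.comp (X ^ 2) + X * O.comp (X ^ 2)) (μ : ℂ) :
    aeval μ F = aeval (μ ^ 2) E + μ * aeval (μ ^ 2) O := by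
  rw [hsplit]
  simp [aeval_comp]

/-- If `E(μ²)` or `O(μ²)` vanishes for a Hurwitz polynomial `E(μ²) + μ O(μ²)`, then `μ²` is real
and negative. -/
theorem IsHurwitz.neg_of_norm_eq (hF : IsHurwitz F) (hdeg : 0 < F.natDegree) {z : ℂ}
    (hz0 : z ≠ 0) (H : ∀ μ : ℂ, μ ^ 2 = z → ‖aeval (-μ) F‖ = ‖aeval μ F‖) :
    z.im = 0 ∧ z.re < 0 := by
  obtain ⟨μ, hμ, hre⟩ := exists_sq_eq_re_nonneg z
  rcases hre.lt_or_eq with h | h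
  · exact absurd (H μ hμ) (hF.norm_aeval_neg_lt hdeg h).ne
  · have him : μ.im ≠ 0 := by
      intro h0
      apply hz0
      have : μ = 0 := Complex.ext h.symm h0
      rw [← hμ, this]; simp
    rw [← hμ, sq, Complex.mul_im, Complex.mul_re, ← h]
    refine ⟨by ring, ?_⟩
    have := mul_self_pos.2 him
    linarith

theorem IsHurwitz.even_zeros_neg (hF : IsHurwitz F) (hdeg : 0 < F.natDegree)
    (hsplit : F = E.comp (X ^ 2) + X * O.comp (X ^ 2)) {z : ℂ} (hz : aeval z E = 0) :
    z.im = 0 ∧ z.re < 0 := by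
  refine hF.neg_of_norm_eq hdeg ?_ ?_
  · rintro rfl
    refine hF 0 le_rfl ?_
    rw [aeval_even_add_odd hsplit]
    simpa using hz
  · intro μ hμ
    rw [aeval_even_add_odd hsplit, aeval_even_add_odd hsplit, neg_sq, hμ, hz]
    simp

/-- Stability says nothing about `O(0)`, since the odd part `μ O(μ²)` vanishes at `0` anyway; hence
the extra hypothesis. -/
theorem IsHurwitz.odd_zeros_neg (hF : IsHurwitz F) (hdeg : 0 < F.natDegree)
    (hsplit : F = E.comp (X ^ 2) + X * O.comp (X ^ 2)) (hO : O.eval 0 ≠ 0) {z : ℂ}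
    (hz : aeval z O = 0) : z.im = 0 ∧ z.re < 0 := by
  refine hF.neg_of_norm_eq hdeg ?_ ?_
  · rintro rfl
    have := aeval_ofReal_complex O 0
    rw [Complex.ofReal_zero, hz] at this
    exact hO (by exact_mod_cast this.symm)
  · intro μ hμ
    rw [aeval_even_add_odd hsplit, aeval_even_add_odd hsplit, neg_sq, hμ, hz]
    simp

theorem aeval_I_mul (hsplit : F = E.comp (X ^ 2) + X * O.comp (X ^ 2)) (w : ℝ) :
    aeval (Complex.I * w) F = ((E.eval (-w ^ 2) : ℝ) : ℂ) +
      Complex.I * ((w * O.eval (-w ^ 2) : ℝ) : ℂ) := by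
  have h : (Complex.I * w) ^ 2 = ((-w ^ 2 : ℝ) : ℂ) := by
    rw [mul_pow, Complex.I_sq]; push_cast; ring
  rw [aeval_even_add_odd hsplit, h, aeval_ofReal_complex, aeval_ofReal_complex]
  push_cast; ring

theorem aeval_I_mul_derivative (hsplit : F = E.comp (X ^ 2) + X * O.comp (X ^ 2)) (w : ℝ) :
    aeval (Complex.I * w) (derivative F) =
      ((O.eval (-w ^ 2) - 2 * w ^ 2 * (derivative O).eval (-w ^ 2) : ℝ) : ℂ) +
      Complex.I * ((2 * w * (derivative E).eval (-w ^ 2) : ℝ) : ℂ) := by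
  have h : (Complex.I * w) ^ 2 = ((-w ^ 2 : ℝ) : ℂ) := by
    rw [mul_pow, Complex.I_sq]; push_cast; ring
  have hd : derivative F = C 2 * X * (derivative E).comp (X ^ 2) + (O.comp (X ^ 2) +
      C 2 * X ^ 2 * (derivative O).comp (X ^ 2)) := by
    rw [hsplit, show (C 2 : ℝ[X]) = 2 from rfl]
    simp [derivative_comp]
    ring
  rw [hd]
  simp only [map_add, map_mul, aeval_X, aeval_C, aeval_comp, map_pow, h, aeval_ofReal_complex]
  push_cast
  simp
  ring

/-- The Wronskian inequality on the negative axis for the even and odd parts of a Hurwitz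
polynomial. -/
theorem IsHurwitz.wronskian_pos (hF : IsHurwitz F) (hdeg : 0 < F.natDegree)
    (hsplit : F = E.comp (X ^ 2) + X * O.comp (X ^ 2)) {x : ℝ} (hx : x < 0) :
    0 < E.eval x * (O.eval x + 2 * x * (derivative O).eval x)
      - 2 * x * ((derivative E).eval x * O.eval x) := by
  have hw : -(√(-x)) ^ 2 = x := by rw [Real.sq_sqrt (by linarith)]; ring
  have hw' : √(-x) * √(-x) = -x := Real.mul_self_sqrt (by linarith)
  set w := √(-x)
  -- At `μ = iw` with `-w² = x`, the numerator of `Re (F'/F)` is the desired expression in `E` and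
  -- `O`.
  have h := hF.re_derivative_div_pos hdeg (z := Complex.I * w) (by simp)
  have hne := hF (Complex.I * w) (by simp)
  rw [Complex.div_re, ← add_div, div_pos_iff_of_pos_right (Complex.normSq_pos.2 hne),
    aeval_I_mul hsplit, aeval_I_mul_derivative hsplit, hw] at h
  simp only [Complex.add_re, Complex.add_im, Complex.ofReal_re, Complex.ofReal_im,
    Complex.I_mul_re, Complex.I_mul_im, neg_zero, add_zero, zero_add] at h
  have e : w ^ 2 = -x := by rw [sq, hw']
  rw [e] at h
  linear_combination h + 2 * (derivative E).eval x * O.eval x * hw'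

theorem IsHurwitz.even_sign (hF : IsHurwitz F) (hdeg : 0 < F.natDegree)
    (hsplit : F = E.comp (X ^ 2) + X * O.comp (X ^ 2)) {x : ℝ} (hx : x < 0)
    (h0 : E.eval x = 0) : 0 < (derivative E).eval x * O.eval x := by
  have := hF.wronskian_pos hdeg hsplit hx
  rw [h0] at this
  nlinarith

theorem IsHurwitz.odd_sign (hF : IsHurwitz F) (hdeg : 0 < F.natDegree)
    (hsplit : F = E.comp (X ^ 2) + X * O.comp (X ^ 2)) {x : ℝ} (hx : x < 0)
    (h0 : O.eval x = 0) : (derivative O).eval x * E.eval x < 0 := by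
  have := hF.wronskian_pos hdeg hsplit hx
  rw [h0] at this
  nlinarith

end HermiteBiehler

/-! ### The Jacobi weight on `(0, 1)` -/

/-- The Jacobi weight `t^a (1-t)^b`. -/
def jacobiWeight (a b t : ℝ) : ℝ := t ^ a * (1 - t) ^ b

theorem jacobiWeight_nonneg {a b t : ℝ} (h0 : 0 ≤ t) (h1 : t ≤ 1) : 0 ≤ jacobiWeight a b t :=
  mul_nonneg (Real.rpow_nonneg h0 _) (Real.rpow_nonneg (by linarith) _)

theorem jacobiWeight_pos {a b t : ℝ} (h0 : 0 < t) (h1 : t < 1) : 0 < jacobiWeight a b t :=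
  mul_pos (Real.rpow_pos_of_pos h0 _) (Real.rpow_pos_of_pos (by linarith) _)

theorem jacobiWeight_intervalIntegrable {a b : ℝ} (ha : -1 < a) (hb : -1 < b) :
    IntervalIntegrable (fun t => (jacobiWeight a b t : ℂ)) MeasureTheory.volume 0 1 := by
  have h := Complex.betaIntegral_convergent (u := ((a + 1 : ℝ) : ℂ)) (v := ((b + 1 : ℝ) : ℂ))
    (by simp; linarith) (by simp; linarith)
  refine h.congr ?_
  intro t ht
  rw [Set.uIoc_of_le zero_le_one] at ht
  simp only [jacobiWeight]
  rw [Complex.ofReal_mul, Complex.ofReal_cpow ht.1.le, Complex.ofReal_cpow (by linarith [ht.2])]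
  push_cast
  simp

theorem jacobiWeight_mul_intervalIntegrable {a b : ℝ} (ha : -1 < a) (hb : -1 < b) (p : ℂ[X]) :
    IntervalIntegrable (fun t : ℝ => (jacobiWeight a b t : ℂ) * p.eval (t : ℂ))
      MeasureTheory.volume 0 1 :=
  (jacobiWeight_intervalIntegrable ha hb).mul_continuousOn (by fun_prop)

/-- The integral of a polynomial on `(0, 1)` against the Jacobi weight. -/
def jacobiIntegral (a b : ℝ) (p : ℂ[X]) : ℂ :=
  ∫ t in (0 : ℝ)..1, (jacobiWeight a b t : ℂ) * p.eval (t : ℂ)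

theorem jacobiIntegral_add {a b : ℝ} (ha : -1 < a) (hb : -1 < b) (p q : ℂ[X]) :
    jacobiIntegral a b (p + q) = jacobiIntegral a b p + jacobiIntegral a b q := by
  rw [jacobiIntegral, jacobiIntegral, jacobiIntegral, ← intervalIntegral.integral_add
    (jacobiWeight_mul_intervalIntegrable ha hb p) (jacobiWeight_mul_intervalIntegrable ha hb q)]
  simp [mul_add]

theorem jacobiIntegral_C_mul (a b : ℝ) (c : ℂ) (p : ℂ[X]) :
    jacobiIntegral a b (C c * p) = c * jacobiIntegral a b p := by
  rw [jacobiIntegral, jacobiIntegral, ← intervalIntegral.integral_const_mul]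
  simp [mul_left_comm]

/-- `jacobiIntegral` as a linear functional. -/
def jacobiFunctional {a b : ℝ} (ha : -1 < a) (hb : -1 < b) : ℂ[X] →ₗ[ℂ] ℂ where
  toFun := jacobiIntegral a b
  map_add' := jacobiIntegral_add ha hb
  map_smul' c p := by rw [smul_eq_C_mul, jacobiIntegral_C_mul]; rfl

theorem jacobiFunctional_C_mul {a b : ℝ} (ha : -1 < a) (hb : -1 < b) (c : ℂ) (p : ℂ[X]) :
    jacobiFunctional ha hb (C c * p) = c * jacobiFunctional ha hb p :=
  jacobiIntegral_C_mul a b c p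

/-- The polynomial with complex conjugate coefficients. -/
abbrev conjPoly (p : ℂ[X]) : ℂ[X] := p.map (starRingEnd ℂ)

theorem eval_conjPoly (p : ℂ[X]) (t : ℝ) :
    (conjPoly p).eval (t : ℂ) = starRingEnd ℂ (p.eval (t : ℂ)) := by
  conv_lhs => rw [← Complex.conj_ofReal t]
  rw [eval_map_apply]

theorem jacobiIntegral_conjPoly (a b : ℝ) (p : ℂ[X]) :
    jacobiIntegral a b (conjPoly p) = starRingEnd ℂ (jacobiIntegral a b p) := by
  rw [jacobiIntegral, jacobiIntegral, ← intervalIntegral.intervalIntegral_conj]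
  simp only [eval_conjPoly, map_mul, Complex.conj_ofReal]

theorem jacobiIntegral_X_mul (a b : ℝ) (p : ℂ[X]) :
    jacobiIntegral a b (X * p) = jacobiIntegral (a + 1) b p := by
  rw [jacobiIntegral, jacobiIntegral]
  refine intervalIntegral.integral_congr_ae (Filter.Eventually.of_forall fun t ht => ?_)
  rw [Set.uIoc_of_le zero_le_one] at ht
  simp only [jacobiWeight, eval_mul, eval_X]
  rw [Real.rpow_add_one ht.1.ne']
  push_cast; ring

theorem jacobiIntegral_one_sub_X_mul (a b : ℝ) (p : ℂ[X]) :
    jacobiIntegral a b ((1 - X) * p) = jacobiIntegral a (b + 1) p := by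
  rw [jacobiIntegral, jacobiIntegral]
  refine intervalIntegral.integral_congr_ae ?_
  -- At `t = 1` the base is `0`, and splitting off one factor of the power can fail (for instance
  -- when `b + 1 = 0`).
  have : ∀ᵐ t : ℝ, t ≠ 1 := by simp [MeasureTheory.ae_iff]
  filter_upwards [this] with t ht1 ht
  simp only [jacobiWeight, eval_mul, eval_X, eval_sub, eval_one]
  rw [Real.rpow_add_one (sub_ne_zero.2 ht1.symm)]
  push_cast; ring

theorem jacobiIntegral_mul_conjPoly_pos {a b : ℝ} (ha : -1 < a) (hb : -1 < b) {q : ℂ[X]}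
    (hq : q ≠ 0) : ∃ c : ℝ, 0 < c ∧ jacobiIntegral a b (q * conjPoly q) = c := by
  have hfun : ∀ t : ℝ, (jacobiWeight a b t : ℂ) * (q * conjPoly q).eval (t : ℂ) =
      ((jacobiWeight a b t * Complex.normSq (q.eval (t : ℂ)) : ℝ) : ℂ) := fun t => by
    rw [eval_mul, eval_conjPoly, Complex.mul_conj]
    push_cast; ring
  refine ⟨∫ t in (0 : ℝ)..1, jacobiWeight a b t * Complex.normSq (q.eval (t : ℂ)), ?_, ?_⟩
  · have hint : IntervalIntegrable
        (fun t : ℝ => jacobiWeight a b t * Complex.normSq (q.eval (t : ℂ)))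
        MeasureTheory.volume 0 1 := by
      have h := jacobiWeight_mul_intervalIntegrable ha hb (q * conjPoly q)
      simp only [hfun] at h
      rw [intervalIntegrable_iff] at h ⊢
      unfold MeasureTheory.IntegrableOn at h ⊢
      simpa using h.re
    rw [intervalIntegral.integral_pos_iff_support_of_nonneg_ae' ?_ hint]
    · refine ⟨one_pos, ?_⟩
      set R : Set ℝ := {t : ℝ | q.eval (t : ℂ) = 0} with hR
      have hfin : R.Finite := by
        have : R ⊆ (fun t : ℝ => (t : ℂ)) ⁻¹' (q.roots.toFinset : Set ℂ) := by
          intro t ht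
          have ht' : q.eval (t : ℂ) = 0 := ht
          simpa [hq] using ht'
        exact ((Finset.finite_toSet _).preimage Complex.ofReal_injective.injOn).subset this
      have hsub : Set.Ioo (0 : ℝ) 1 \ R ⊆ Function.support
          (fun t : ℝ => jacobiWeight a b t * Complex.normSq (q.eval (t : ℂ))) ∩ Set.Ioc 0 1 := by
        rintro t ⟨⟨h0, h1⟩, hR'⟩
        refine ⟨?_, h0, h1.le⟩
        exact mul_ne_zero (jacobiWeight_pos h0 h1).ne'
          (fun h => hR' (Complex.normSq_eq_zero.1 h))
      refine lt_of_lt_of_le ?_ (MeasureTheory.measure_mono hsub)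
      rw [MeasureTheory.measure_sdiff_null (hfin.measure_zero _)]
      simp
    · rw [Set.uIoc_of_le zero_le_one]
      refine (MeasureTheory.ae_restrict_iff' measurableSet_Ioc).2
        (Filter.Eventually.of_forall fun t ht => ?_)
      exact mul_nonneg (jacobiWeight_nonneg ht.1.le ht.2) (Complex.normSq_nonneg _)
  · rw [← intervalIntegral.integral_ofReal, jacobiIntegral]
    simp only [hfun]

/-- Integration by parts against the Jacobi weight. -/
theorem jacobiIntegral_parts {a b : ℝ} (ha : -1 < a) (hb : -1 < b) (p : ℂ[X]) :
    jacobiIntegral a b ((C (a + 1 : ℂ) * (1 - X) - C (b + 1 : ℂ) * X) * p +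
      X * (1 - X) * derivative p) = 0 := by
  -- The integrand is the derivative of `t^(a+1) (1-t)^(b+1) p`, whose boundary values vanish
  -- because both exponents are positive.
  have h := intervalIntegral.integral_eq_sub_of_hasDerivAt_of_le (a := (0 : ℝ)) (b := 1)
    (f := fun t : ℝ => (jacobiWeight (a + 1) (b + 1) t : ℂ) * p.eval (t : ℂ)) zero_le_one ?_ ?_
    (jacobiWeight_mul_intervalIntegrable ha hb ((C (a + 1 : ℂ) * (1 - X) - C (b + 1 : ℂ) * X) * p +
      X * (1 - X) * derivative p))
  · rw [jacobiIntegral, h]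
    simp [jacobiWeight, Real.zero_rpow (show a + 1 ≠ 0 by linarith),
      Real.zero_rpow (show b + 1 ≠ 0 by linarith)]
  · refine ContinuousOn.mul ?_ (by fun_prop)
    refine Complex.continuous_ofReal.comp_continuousOn ?_
    unfold jacobiWeight
    refine ContinuousOn.mul ?_ ?_
    · exact (Real.continuous_rpow_const (by linarith)).continuousOn
    · exact ((Real.continuous_rpow_const (by linarith)).comp
        (continuous_const.sub continuous_id)).continuousOn
  · rintro t ⟨h0, h1⟩
    have hw : HasDerivAt (fun t : ℝ => jacobiWeight (a + 1) (b + 1) t)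
        (jacobiWeight a b t * ((a + 1) * (1 - t) - (b + 1) * t)) t := by
      have d1 := Real.hasDerivAt_rpow_const (x := t) (p := a + 1) (Or.inl h0.ne')
      have d2 := ((hasDerivAt_id t).const_sub 1).rpow_const (p := b + 1)
        (Or.inl (by simp; linarith))
      have d3 := d1.mul d2
      convert! d3 using 1
      simp only [jacobiWeight, id, add_sub_cancel_right]
      rw [Real.rpow_add_one h0.ne', Real.rpow_add_one (by linarith : (1 - t) ≠ 0)]
      ring
    have hp : HasDerivAt (fun t : ℝ => p.eval (t : ℂ)) ((derivative p).eval (t : ℂ)) t :=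
      (p.hasDerivAt (t : ℂ)).comp_ofReal
    have := hw.ofReal_comp.mul hp
    convert! this using 1
    simp only [jacobiWeight, eval_add, eval_mul, eval_sub, eval_C, eval_X, eval_one]
    rw [Real.rpow_add_one h0.ne', Real.rpow_add_one (by linarith : (1 - t) ≠ 0)]
    push_cast; ring

/-- The energy inequality behind the stability of the Jacobi sums. -/
theorem jacobiIntegral_energy_pos {α β : ℝ} (h1 : -1 < α) (h2 : α < 1) (hβ : 0 < β) {q : ℂ[X]}
    (hq : q ≠ 0) : 0 < (jacobiIntegral α β (derivative (X * q) * conjPoly q)).re := by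
  set u := q * conjPoly q with hu
  have hβ' : -1 < β := by linarith
  have hβ'' : -1 < β - 1 := by linarith
  obtain ⟨c, hc, ec⟩ := jacobiIntegral_mul_conjPoly_pos h1 hβ' hq
  obtain ⟨d, hd, ed⟩ := jacobiIntegral_mul_conjPoly_pos (show -1 < α + 1 by linarith) hβ'' hq
  -- With `u = |q|²` on the real axis, `c = ∫ t^α (1-t)^β u` and `d = ∫ t^(α+1) (1-t)^(β-1) u`,
  -- parts with exponents `(α, β-1)` express `∫ t^α (1-t)^β t u'` as `β d - (α+1) c`. Since twice
  -- the real part sought is `2c` plus this integral, it equals `(1-α) c + β d`.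
  have hparts := jacobiIntegral_parts h1 hβ'' u
  have e1 : (C (α + 1 : ℂ) * (1 - X) - C (((β - 1 : ℝ) : ℂ) + 1) * X) * u +
      X * (1 - X) * derivative u = (1 - X) * (C (α + 1 : ℂ) * u + X * derivative u) +
      C (-β : ℂ) * (X * u) := by
    have : ((β - 1 : ℝ) : ℂ) + 1 = β := by push_cast; ring
    rw [this, C_neg]
    ring
  rw [e1, jacobiIntegral_add h1 hβ'', jacobiIntegral_one_sub_X_mul, jacobiIntegral_C_mul,
    jacobiIntegral_X_mul, sub_add_cancel, jacobiIntegral_add h1 hβ', jacobiIntegral_C_mul,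
    ec, ed] at hparts
  set v := derivative (X * q) * conjPoly q with hv
  have e2 : v + conjPoly v = C 2 * u + X * derivative u := by
    have hcc : conjPoly (conjPoly q) = q := by
      rw [conjPoly, conjPoly, Polynomial.map_map]
      ext n
      simp
    have hvc : conjPoly v = derivative (X * conjPoly q) * q := by
      rw [hv, conjPoly, Polynomial.map_mul, ← derivative_map, Polynomial.map_mul, map_X]
      rw [show (conjPoly q).map (starRingEnd ℂ) = q from hcc]
    rw [hvc, hv, hu, show (C 2 : ℂ[X]) = 2 from rfl]
    simp only [derivative_mul, derivative_X]
    ring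
  have e3 := jacobiIntegral_add h1 hβ' v (conjPoly v)
  rw [e2, jacobiIntegral_add h1 hβ', jacobiIntegral_C_mul, ec, jacobiIntegral_conjPoly] at e3
  have r1 := congrArg Complex.re hparts
  have r2 := congrArg Complex.re e3
  simp at r1 r2
  nlinarith [mul_pos hβ hd, mul_pos (sub_pos.2 h2) hc]

/-! ### Jacobi polynomials in the variable `t = (1 - x) / 2` -/

theorem risingFactorial_zero (x : ℝ) : risingFactorial x 0 = 1 := by simp [risingFactorial]

theorem risingFactorial_succ (x : ℝ) (k : ℕ) :
    risingFactorial x (k + 1) = risingFactorial x k * (x + k) :=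
  ascPochhammer_succ_eval k x

theorem risingFactorial_succ_left (x : ℝ) (k : ℕ) :
    risingFactorial x (k + 1) = x * risingFactorial (x + 1) k := by
  simp [risingFactorial, ascPochhammer_succ_left, eval_comp]

theorem risingFactorial_pos {x : ℝ} (hx : 0 < x) (k : ℕ) : 0 < risingFactorial x k :=
  ascPochhammer_pos k x hx

theorem neg_one_pow_mul_risingFactorial_neg_pos {n k : ℕ} (hk : k ≤ n) :
    0 < (-1) ^ k * risingFactorial (-(n : ℝ)) k := by
  induction k with
  | zero => simp [risingFactorial_zero]
  | succ k ih =>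
    rw [risingFactorial_succ, pow_succ]
    have h1 := ih (by omega)
    have h2 : (0 : ℝ) < n - k := sub_pos.2 (by exact_mod_cast hk)
    nlinarith [mul_pos h1 h2]

theorem risingFactorial_neg_eq_zero {n k : ℕ} (hk : n < k) : risingFactorial (-(n : ℝ)) k = 0 := by
  induction k, hk using Nat.le_induction with
  | base => rw [risingFactorial_succ]; simp
  | succ k _ ih => rw [risingFactorial_succ, ih, zero_mul]

/-- The coefficients of the Jacobi polynomial in powers of `t = (1 - x) / 2`. -/
def jacobiCoeff (α β : ℝ) (n k : ℕ) : ℝ :=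
  risingFactorial (α + 1) n / (n.factorial : ℝ) *
    (risingFactorial (-(n : ℝ)) k * risingFactorial ((n : ℝ) + α + β + 1) k /
      ((k.factorial : ℝ) * risingFactorial (α + 1) k))

/-- The Jacobi polynomial in the variable `t = (1 - x) / 2`. -/
def jacobiShifted (α β : ℝ) (n : ℕ) : ℝ[X] :=
  ∑ k ∈ Finset.range (n + 1), C (jacobiCoeff α β n k) * X ^ k

theorem jacobiPoly_eq_comp (α β : ℝ) (n : ℕ) :
    jacobiPoly α β n = (jacobiShifted α β n).comp (C (1 / 2 : ℝ) * (1 - X)) := by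
  rw [jacobiPoly, jacobiShifted, Finset.mul_sum, ← coe_compRingHom_apply, map_sum]
  refine Finset.sum_congr rfl fun k _ => ?_
  rw [coe_compRingHom_apply, jacobiCoeff, mul_comp, C_comp, pow_comp, X_comp, C_mul (a := _ / _), mul_assoc]

theorem coeff_jacobiShifted (α β : ℝ) (n k : ℕ) :
    (jacobiShifted α β n).coeff k = jacobiCoeff α β n k := by
  rw [jacobiShifted, finsetSum_coeff]
  simp only [coeff_C_mul_X_pow, Finset.sum_ite_eq, Finset.mem_range]
  split_ifs with h
  · rfl
  · rw [jacobiCoeff, risingFactorial_neg_eq_zero (by omega)]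
    simp

theorem natDegree_jacobiShifted_le (α β : ℝ) (n : ℕ) : (jacobiShifted α β n).natDegree ≤ n := by
  rw [natDegree_le_iff_coeff_eq_zero]
  intro k hk
  rw [coeff_jacobiShifted, jacobiCoeff, risingFactorial_neg_eq_zero hk]
  simp

theorem eval_iterate_derivative_comp (p : ℝ[X]) (k : ℕ) :
    (derivative^[k] (p.comp (C (1 / 2 : ℝ) * (1 - X)))).eval 1 =
      (-1 / 2) ^ k * (derivative^[k] p).eval 0 := by
  induction k generalizing p with
  | zero => simp [eval_comp]
  | succ k ih =>
    have h : derivative (p.comp (C (1 / 2 : ℝ) * (1 - X))) =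
        C (-1 / 2) * (derivative p).comp (C (1 / 2 : ℝ) * (1 - X)) := by
      have hl : derivative (C (1 / 2 : ℝ) * (1 - X)) = C (-1 / 2) := by
        rw [derivative_C_mul, derivative_sub, derivative_one, derivative_X, zero_sub, mul_neg,
          mul_one, ← C_neg]
        norm_num
      rw [derivative_comp, hl]
    rw [Function.iterate_succ_apply, Function.iterate_succ_apply, h, iterate_derivative_C_mul,
      eval_mul, eval_C, ih, pow_succ']
    ring

theorem eval_zero_iterate_derivative {R : Type*} [CommRing R] (p : R[X]) (k : ℕ) :
    (derivative^[k] p).eval 0 = (k.factorial : R) * p.coeff k := by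
  rw [← coeff_zero_eq_eval_zero, coeff_iterate_derivative, zero_add, Nat.descFactorial_self,
    nsmul_eq_mul]

/-- The derivatives of a Jacobi polynomial at `1`. -/
theorem eval_one_iterate_derivative_jacobiPoly (α β : ℝ) (n k : ℕ) :
    (derivative^[k] (jacobiPoly α β n)).eval 1 =
      (-1 / 2) ^ k * ((k.factorial : ℝ) * jacobiCoeff α β n k) := by
  rw [jacobiPoly_eq_comp, eval_iterate_derivative_comp, eval_zero_iterate_derivative,
    coeff_jacobiShifted]

theorem neg_one_pow_mul_jacobiCoeff_pos {α β : ℝ} (hα : -1 < α) (hαβ : -1 < α + β) {n k : ℕ}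
    (hk : k ≤ n) : 0 < (-1) ^ k * jacobiCoeff α β n k := by
  have h1 := risingFactorial_pos (show 0 < α + 1 by linarith)
  have h2 := risingFactorial_pos (show 0 < (n : ℝ) + α + β + 1 by
    have : (0 : ℝ) ≤ n := n.cast_nonneg
    linarith) k
  have h3 := neg_one_pow_mul_risingFactorial_neg_pos hk
  have e : (-1) ^ k * jacobiCoeff α β n k = risingFactorial (α + 1) n / (n.factorial : ℝ) *
      (((-1) ^ k * risingFactorial (-(n : ℝ)) k) * risingFactorial ((n : ℝ) + α + β + 1) k /
      ((k.factorial : ℝ) * risingFactorial (α + 1) k)) := by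
    rw [jacobiCoeff]; ring
  rw [e]
  have := h1 n
  have := h1 k
  positivity

theorem eval_one_iterate_derivative_jacobiPoly_pos {α β : ℝ} (hα : -1 < α) (hαβ : -1 < α + β)
    {n k : ℕ} (hk : k ≤ n) : 0 < (derivative^[k] (jacobiPoly α β n)).eval 1 := by
  rw [eval_one_iterate_derivative_jacobiPoly]
  have h := neg_one_pow_mul_jacobiCoeff_pos hα hαβ hk
  have e : (-1 / 2 : ℝ) ^ k * ((k.factorial : ℝ) * jacobiCoeff α β n k) =
      (1 / 2) ^ k * (k.factorial : ℝ) * ((-1) ^ k * jacobiCoeff α β n k) := by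
    rw [show (-1 / 2 : ℝ) = (1 / 2) * (-1) by norm_num, mul_pow]; ring
  rw [e]
  positivity

/-- Ratio of consecutive hypergeometric terms, with denominators cleared. It holds for all `k`, the
factor `k - n` encoding termination, and is the differential equation read coefficientwise. -/
theorem jacobiCoeff_succ {α : ℝ} (hα : -1 < α) (β : ℝ) (n k : ℕ) :
    (k + 1) * (α + 1 + k) * jacobiCoeff α β n (k + 1) =
      (k - n) * (n + α + β + 1 + k) * jacobiCoeff α β n k := by
  have h1 := (risingFactorial_pos (show 0 < α + 1 by linarith) k).ne'
  have h2 : α + 1 + (k : ℝ) ≠ 0 := by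
    have : (0 : ℝ) ≤ k := k.cast_nonneg
    linarith
  have h3 : (k.factorial : ℝ) ≠ 0 := by positivity
  have h4 : (n.factorial : ℝ) ≠ 0 := by positivity
  have h5 : (k + 1 : ℝ) ≠ 0 := by positivity
  simp only [jacobiCoeff, risingFactorial_succ, Nat.factorial_succ]
  push_cast
  field_simp
  ring

/-- The Jacobi differential equation in the variable `t`. -/
theorem jacobiShifted_ode {α : ℝ} (hα : -1 < α) (β : ℝ) (n : ℕ) :
    X * (1 - X) * derivative (derivative (jacobiShifted α β n)) +
      (C (α + 1) * (1 - X) - C (β + 1) * X) * derivative (jacobiShifted α β n) +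
      C (n * (n + α + β + 1)) * jacobiShifted α β n = 0 := by
  have hr := jacobiCoeff_succ hα β n
  have hc := coeff_jacobiShifted α β n
  set T := jacobiShifted α β n
  have e : X * (1 - X) * derivative (derivative T) +
      (C (α + 1) * (1 - X) - C (β + 1) * X) * derivative T + C (n * (n + α + β + 1)) * T =
      X * derivative (derivative T) - X * (X * derivative (derivative T)) +
      C (α + 1) * derivative T - C (α + β + 2) * (X * derivative T) +
      C (n * (n + α + β + 1)) * T := by
    simp only [C_add, C_1, show (C 2 : ℝ[X]) = 1 + 1 by rw [← C_1, ← C_add]; norm_num]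
    ring
  rw [e]
  ext k
  simp only [coeff_add, coeff_sub, coeff_C_mul, coeff_zero]
  rcases k with _ | _ | k
  · have := hr 0
    simp [coeff_derivative, hc] at this ⊢
    linarith
  · have := hr 1
    simp [coeff_X_mul, coeff_derivative, hc] at this ⊢
    linarith
  · have := hr (k + 2)
    simp only [coeff_X_mul, coeff_derivative, hc] at this ⊢
    push_cast at this ⊢
    linear_combination this

/-- Polynomial eigenfunctions of the Jacobi operator are orthogonal to polynomials of lower
degree. -/
theorem jacobiIntegral_mul_X_pow_eq_zero {α β : ℝ} (hα : -1 < α) (hβ : -1 < β)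
    (hαβ : -1 < α + β) {n : ℕ} {T : ℂ[X]}
    (hT : X * (1 - X) * derivative (derivative T) +
      (C (α + 1 : ℂ) * (1 - X) - C (β + 1 : ℂ) * X) * derivative T +
      C (n * (n + α + β + 1) : ℂ) * T = 0) {j : ℕ} (hj : j < n) :
    jacobiIntegral α β (T * X ^ j) = 0 := by
  have hsym : ∀ Y : ℂ[X], jacobiIntegral α β (T * (X * (1 - X) * derivative (derivative Y) +
      (C (α + 1 : ℂ) * (1 - X) - C (β + 1 : ℂ) * X) * derivative Y +
      C (n * (n + α + β + 1) : ℂ) * Y)) = 0 := by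
    intro Y
    -- Self-adjointness of the Jacobi operator `L`: `T·LY - Y·LT` is the integrand of the parts
    -- formula for `T Y' - T' Y`.
    rw [← jacobiIntegral_parts hα hβ (T * derivative Y - derivative T * Y)]
    congr 1
    simp only [derivative_sub, derivative_mul]
    linear_combination Y * hT
  -- Distinct eigenvalues: the difference factors as `(n - i)(n + i + α + β + 1)`.
  have hne : ∀ i : ℕ, i < n → (n * (n + α + β + 1) - i * (i + α + β + 1) : ℂ) ≠ 0 := by
    intro i hi
    have h1 : (0 : ℝ) < n - i := sub_pos.2 (by exact_mod_cast hi)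
    have h2 : (0 : ℝ) < n + i + α + β + 1 := by
      have : (0 : ℝ) ≤ n := n.cast_nonneg
      have : (0 : ℝ) ≤ i := i.cast_nonneg
      linarith
    have h3 := (mul_pos h1 h2).ne'
    intro h
    apply h3
    have : (((n - i) * (n + i + α + β + 1) : ℝ) : ℂ) = 0 := by
      push_cast; linear_combination h
    exact_mod_cast this
  induction j with
  | zero =>
    have h := hsym 1
    have e : T * (X * (1 - X) * derivative (derivative (1 : ℂ[X])) +
        (C (α + 1 : ℂ) * (1 - X) - C (β + 1 : ℂ) * X) * derivative (1 : ℂ[X]) +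
        C (n * (n + α + β + 1) : ℂ) * 1) = C (n * (n + α + β + 1) : ℂ) * (T * X ^ 0) := by
      simp only [derivative_one, map_zero]; ring
    rw [e, jacobiIntegral_C_mul] at h
    refine (mul_eq_zero.1 h).resolve_left ?_
    simpa using hne 0 hj
  | succ j ih =>
    have h := hsym (X ^ (j + 1))
    have hd : (X : ℂ[X]) * derivative (X ^ j) = C (j : ℂ) * X ^ j := by
      rcases j with _ | j
      · simp
      · rw [derivative_X_pow, Nat.add_sub_cancel]; ring
    -- The operator is triangular on monomials: `X^(j+1)` yields a multiple of itself and one of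
    -- `X^j`, the latter killed by induction.
    have e : T * (X * (1 - X) * derivative (derivative (X ^ (j + 1) : ℂ[X])) +
        (C (α + 1 : ℂ) * (1 - X) - C (β + 1 : ℂ) * X) * derivative (X ^ (j + 1) : ℂ[X]) +
        C (n * (n + α + β + 1) : ℂ) * X ^ (j + 1)) =
        C ((j + 1) * (α + 1 + j) : ℂ) * (T * X ^ j) +
        C (n * (n + α + β + 1) - (j + 1 : ℕ) * ((j + 1 : ℕ) + α + β + 1) : ℂ) *
          (T * X ^ (j + 1)) := by
      rw [derivative_X_pow, Nat.add_sub_cancel, derivative_C_mul]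
      push_cast
      simp only [C_add, C_sub, C_mul, C_1] at hd ⊢
      linear_combination (T * (1 - X) * (C (j : ℂ) + 1)) * hd
    rw [e, jacobiIntegral_add hα hβ, jacobiIntegral_C_mul, jacobiIntegral_C_mul,
      ih (by omega), mul_zero, zero_add] at h
    exact (mul_eq_zero.1 h).resolve_left (hne _ hj)

theorem jacobiIntegral_mul_eq_coeff_mul {α β : ℝ} (hα : -1 < α) (hβ : -1 < β) {n : ℕ} {T : ℂ[X]}
    (hT : ∀ j < n, jacobiIntegral α β (T * X ^ j) = 0) {p : ℂ[X]} (hp : p.natDegree ≤ n) :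
    jacobiIntegral α β (T * p) = p.coeff n * jacobiIntegral α β (T * X ^ n) := by
  have h : T * p = ∑ i ∈ Finset.range (n + 1), C (p.coeff i) * (T * X ^ i) := by
    conv_lhs => rw [p.as_sum_range_C_mul_X_pow' (Nat.lt_succ_of_le hp), Finset.mul_sum]
    exact Finset.sum_congr rfl fun i _ => by ring
  change jacobiFunctional hα hβ (T * p) = _
  rw [h, map_sum, Finset.sum_range_succ, Finset.sum_eq_zero, zero_add, jacobiFunctional_C_mul]
  · rfl
  · intro i hi
    rw [jacobiFunctional_C_mul, show jacobiFunctional hα hβ (T * X ^ i) = 0 from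
      hT i (Finset.mem_range.1 hi), mul_zero]

/-! ### Stability -/

/-- A solution of `r + ν r' = Q`. -/
def resolventSum (ν : ℂ) (N : ℕ) (Q : ℂ[X]) : ℂ[X] :=
  ∑ k ∈ Finset.range (N + 1), C ((-ν) ^ k) * derivative^[k] Q

/-- The sum is the Neumann series of `(1 + ν D)⁻¹` applied to `Q`, finite because `D` is nilpotent
on polynomials; the identity telescopes. -/
theorem resolventSum_add_derivative (ν : ℂ) {N : ℕ} {Q : ℂ[X]} (hQ : Q.natDegree ≤ N) :
    resolventSum ν N Q + C ν * derivative (resolventSum ν N Q) = Q := by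
  have h : resolventSum ν N Q + C ν * derivative (resolventSum ν N Q) =
      ∑ k ∈ Finset.range (N + 1), (C ((-ν) ^ k) * derivative^[k] Q -
        C ((-ν) ^ (k + 1)) * derivative^[k + 1] Q) := by
    rw [resolventSum, derivative_sum, Finset.mul_sum, ← Finset.sum_add_distrib]
    refine Finset.sum_congr rfl fun k _ => ?_
    rw [derivative_C_mul, Function.iterate_succ_apply', pow_succ, C_mul, C_neg]
    ring
  rw [h, Finset.sum_range_sub' (fun k => C ((-ν) ^ k) * derivative^[k] Q),
    iterate_derivative_eq_zero (Nat.lt_succ_of_le hQ)]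
  simp

theorem natDegree_resolventSum_le (ν : ℂ) {N : ℕ} {Q : ℂ[X]} (hQ : Q.natDegree ≤ N) :
    (resolventSum ν N Q).natDegree ≤ N :=
  natDegree_sum_le_of_forall_le _ _ fun k _ => (natDegree_C_mul_le _ _).trans
    ((natDegree_iterate_derivative Q k).trans ((Nat.sub_le _ _).trans hQ))

theorem coeff_resolventSum (ν : ℂ) {N : ℕ} {Q : ℂ[X]} (hQ : Q.natDegree ≤ N) :
    (resolventSum ν N Q).coeff N = Q.coeff N := by
  have h := congrArg (fun p => p.coeff N) (resolventSum_add_derivative ν hQ)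
  simp only [coeff_add, coeff_C_mul, coeff_derivative] at h
  rw [coeff_eq_zero_of_natDegree_lt
    (Nat.lt_succ_of_le (natDegree_resolventSum_le ν hQ))] at h
  simpa using h

/-- The Jacobi polynomial in `t` with complex coefficients. -/
abbrev jacobiShiftedC (α β : ℝ) (n : ℕ) : ℂ[X] := (jacobiShifted α β n).map (algebraMap ℝ ℂ)

theorem jacobiShiftedC_orthogonal {α β : ℝ} (hα : -1 < α) (hβ : 0 < β) {n j : ℕ} (hj : j < n) :
    jacobiIntegral α β (jacobiShiftedC α β n * X ^ j) = 0 := by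
  refine jacobiIntegral_mul_X_pow_eq_zero hα (by linarith) (by linarith) ?_ hj
  have := congrArg (Polynomial.map (algebraMap ℝ ℂ)) (jacobiShifted_ode hα β n)
  simpa [Polynomial.map_add, Polynomial.map_mul, derivative_map] using this

/-- The core of the proof. A zero at the origin gives `r = X q`; testing the resolvent equation
against `conj q` in the Jacobi inner product yields three terms that cannot cancel. -/
theorem resolventSum_eval_zero_ne_zero {α β : ℝ} (h1 : -1 < α) (h2 : α < 1) (hβ : 0 < β) (m : ℕ)
    {ν s : ℂ} (hν : ν ≠ 0) (hν' : 0 ≤ ν.re) (hs : 0 ≤ (s / ν).re) :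
    (resolventSum ν (m + 1) (jacobiShiftedC α β (m + 1) + C s * jacobiShiftedC α β m)).eval 0 ≠ 0 := by
  intro h0
  have hβ' : -1 < β := by linarith
  set T := jacobiShiftedC α β (m + 1) with hTdef
  set S := jacobiShiftedC α β m with hSdef
  have hTd : T.natDegree ≤ m + 1 := natDegree_map_le.trans (natDegree_jacobiShifted_le α β _)
  have hSd : S.natDegree ≤ m := natDegree_map_le.trans (natDegree_jacobiShifted_le α β _)
  set l := jacobiCoeff α β (m + 1) (m + 1) with hl
  set k := jacobiCoeff α β m m with hk
  have hTc : T.coeff (m + 1) = l := by rw [hTdef, coeff_map, coeff_jacobiShifted]; rfl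
  have hSc : S.coeff m = k := by rw [hSdef, coeff_map, coeff_jacobiShifted]; rfl
  -- In the variable `t` the leading coefficients alternate in sign with the degree; this is what
  -- makes the weight of `s / ν` below positive.
  have hlk : l * k < 0 := by
    have a1 := neg_one_pow_mul_jacobiCoeff_pos (β := β) h1 (by linarith) (le_refl (m + 1))
    have a2 := neg_one_pow_mul_jacobiCoeff_pos (β := β) h1 (by linarith) (le_refl m)
    have a3 := mul_pos a1 a2
    have a4 : ((-1 : ℝ) ^ m) * (-1) ^ m = 1 := by rw [← mul_pow]; simp
    rw [pow_succ] at a3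
    have a5 : (-1 : ℝ) ^ m * -1 * l * ((-1) ^ m * k) = -(l * k) := by
      linear_combination (-(l * k)) * a4
    rw [a5] at a3
    linarith
  have hl0 : l ≠ 0 := by rintro h; simp [h] at hlk
  have hk0 : k ≠ 0 := by rintro h; simp [h] at hlk
  set Q := T + C s * S with hQ
  have hQd : Q.natDegree ≤ m + 1 :=
    natDegree_add_le_of_degree_le hTd ((natDegree_C_mul_le _ _).trans (hSd.trans m.le_succ))
  have hr := resolventSum_add_derivative ν hQd
  have hrd := natDegree_resolventSum_le ν hQd
  have hrc := coeff_resolventSum ν hQd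
  generalize resolventSum ν (m + 1) Q = r at h0 hr hrd hrc
  rw [← coeff_zero_eq_eval_zero, ← X_dvd_iff] at h0
  obtain ⟨q, rfl⟩ := h0
  have hqc : q.coeff m = l := by
    rw [coeff_X_mul, hQ, coeff_add, coeff_C_mul, hTc,
      coeff_eq_zero_of_natDegree_lt (Nat.lt_succ_of_le hSd)] at hrc
    simpa using hrc
  have hqd : q.natDegree ≤ m := by
    rw [natDegree_le_iff_coeff_eq_zero]
    intro i hi
    rw [← coeff_X_mul]
    exact coeff_eq_zero_of_natDegree_lt (by omega)
  have hq0 : q ≠ 0 := by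
    rintro rfl
    rw [coeff_zero] at hqc
    exact hl0 (by exact_mod_cast hqc.symm)
  have hq' : (conjPoly q).natDegree ≤ m := natDegree_map_le.trans hqd
  have hS0 : S ≠ 0 := by
    intro h
    rw [h, coeff_zero] at hSc
    exact hk0 (by exact_mod_cast hSc.symm)
  obtain ⟨A, hA, eA⟩ := jacobiIntegral_mul_conjPoly_pos (show -1 < α + 1 by linarith) hβ' hq0
  obtain ⟨κ, hκ, eκ⟩ := jacobiIntegral_mul_conjPoly_pos h1 hβ' hS0
  have hB := jacobiIntegral_energy_pos h1 h2 hβ hq0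
  have hSo : ∀ j < m, jacobiIntegral α β (S * X ^ j) = 0 :=
    fun j hj => jacobiShiftedC_orthogonal h1 hβ hj
  have hTo : ∀ j < m + 1, jacobiIntegral α β (T * X ^ j) = 0 :=
    fun j hj => jacobiShiftedC_orthogonal h1 hβ hj
  rw [jacobiIntegral_mul_eq_coeff_mul h1 hβ' hSo
    ((natDegree_map_le (f := starRingEnd ℂ)).trans hSd), coeff_map, hSc, Complex.conj_ofReal] at eκ
  have eT := jacobiIntegral_mul_eq_coeff_mul h1 hβ' hTo (hq'.trans m.le_succ)
  rw [coeff_eq_zero_of_natDegree_lt (Nat.lt_succ_of_le hq'), zero_mul] at eT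
  have eS := jacobiIntegral_mul_eq_coeff_mul h1 hβ' hSo hq'
  rw [coeff_map, hqc, Complex.conj_ofReal] at eS
  have key := congrArg (fun p => jacobiIntegral α β (p * conjPoly q)) hr
  have e1 : (X * q + C ν * derivative (X * q)) * conjPoly q =
      X * (q * conjPoly q) + C ν * (derivative (X * q) * conjPoly q) := by ring
  have e2 : Q * conjPoly q = T * conjPoly q + C s * (S * conjPoly q) := by rw [hQ]; ring
  simp only [e1, e2] at key
  rw [jacobiIntegral_add h1 hβ', jacobiIntegral_add h1 hβ', jacobiIntegral_C_mul,
    jacobiIntegral_C_mul, jacobiIntegral_X_mul, eA, eT, eS, zero_add] at key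
  set B := jacobiIntegral α β (derivative (X * q) * conjPoly q)
  set K := jacobiIntegral α β (S * X ^ m)
  have hkC : (k : ℂ) ≠ 0 := by exact_mod_cast hk0
  -- Since `q` has leading coefficient `l` and `∫ T_m² = k K = κ`, the right-hand side is `s l K = s
  -- (l/k) κ`. Dividing by `ν` isolates the energy term `B`.
  have e3 : (A : ℂ) * (1 / ν) + B + ((-(l / k) * κ : ℝ) : ℂ) * (s / ν) = 0 := by
    have hK : K = κ / k := by rw [eq_div_iff hkC, mul_comm]; exact eκ
    rw [hK] at key
    push_cast
    field_simp at key ⊢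
    linear_combination key
  have e4 := congrArg Complex.re e3
  rw [Complex.add_re, Complex.add_re, Complex.re_ofReal_mul, Complex.re_ofReal_mul,
    Complex.zero_re] at e4
  have hρ : 0 < -(l / k) * κ := by
    refine mul_pos (neg_pos.2 ?_) hκ
    rw [div_neg_iff]
    exact mul_neg_iff.1 hlk
  have hinv : 0 ≤ (1 / ν).re := by
    rw [one_div, Complex.inv_re]
    exact div_nonneg hν' (Complex.normSq_nonneg _)
  linarith [mul_nonneg hA.le hinv, mul_nonneg hρ.le hs]

/-! ### Stability of the full derivative sums and interlacing of their even and odd parts. -/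

/-- The polynomial `∑ₖ (P_n^{(α,β)})^{(k)}(1) μ^k`. -/
def jacobiGen (α β : ℝ) (n : ℕ) : ℝ[X] :=
  ∑ k ∈ Finset.range (n + 1), C ((derivative^[k] (jacobiPoly α β n)).eval 1) * X ^ k

/-- The odd counterpart of `jacobiPhi`. -/
def jacobiPsi (α β : ℝ) (n : ℕ) : ℝ[X] :=
  ∑ k ∈ Finset.range ((n + 1) / 2),
    C ((derivative^[2 * k + 1] (jacobiPoly α β n)).eval 1) * X ^ k

theorem sum_range_even_add_odd {M : Type*} [AddCommMonoid M] (f : ℕ → M) (n : ℕ) :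
    ∑ k ∈ Finset.range (n + 1), f k = ∑ k ∈ Finset.range (n / 2 + 1), f (2 * k) +
      ∑ k ∈ Finset.range ((n + 1) / 2), f (2 * k + 1) := by
  induction n with
  | zero => simp
  | succ n ih =>
    rw [Finset.sum_range_succ, ih]
    rcases Nat.even_or_odd' n with ⟨m, rfl | rfl⟩
    · rw [show (2 * m + 1) / 2 = m by omega, show (2 * m) / 2 = m by omega,
        show (2 * m + 1 + 1) / 2 = m + 1 by omega, Finset.sum_range_succ (fun k => f (2 * k + 1)),
        add_assoc]
    · rw [show (2 * m + 1) / 2 = m by omega, show (2 * m + 1 + 1) / 2 = m + 1 by omega,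
        show (2 * m + 1 + 1 + 1) / 2 = m + 1 by omega, Finset.sum_range_succ _ (m + 1),
        show 2 * (m + 1) = 2 * m + 1 + 1 by ring]
      abel

theorem jacobiGen_eq (α β : ℝ) (n : ℕ) :
    jacobiGen α β n = (jacobiPhi α β n).comp (X ^ 2) + X * (jacobiPsi α β n).comp (X ^ 2) := by
  rw [jacobiGen, sum_range_even_add_odd, jacobiPhi, jacobiPsi, ← coe_compRingHom_apply,
    ← coe_compRingHom_apply, map_sum, map_sum, Finset.mul_sum]
  congr 1 <;> refine Finset.sum_congr rfl fun k _ => ?_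
  · simp [pow_mul]
  · simp only [map_mul, coe_compRingHom_apply, C_comp, map_pow, X_comp]
    ring

theorem coeff_jacobiGen {α β : ℝ} {n k : ℕ} (hk : k ≤ n) :
    (jacobiGen α β n).coeff k = (derivative^[k] (jacobiPoly α β n)).eval 1 := by
  rw [jacobiGen, finsetSum_coeff]
  simp only [coeff_C_mul_X_pow, Finset.sum_ite_eq, Finset.mem_range]
  rw [if_pos (by omega)]

theorem natDegree_jacobiGen_pos {α β : ℝ} (hα : -1 < α) (hαβ : -1 < α + β) {n : ℕ} (hn : 0 < n) :
    0 < (jacobiGen α β n).natDegree := by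
  refine hn.trans_le (le_natDegree_of_ne_zero ?_)
  rw [coeff_jacobiGen le_rfl]
  exact (eval_one_iterate_derivative_jacobiPoly_pos hα hαβ le_rfl).ne'

/-- The truncation order `N` is left free so that `F_{m+1}` and `F_m` can share one, making the
resolvent sum linear in the pair. -/
theorem aeval_jacobiGen (α β : ℝ) {n N : ℕ} (hN : n ≤ N) (μ : ℂ) :
    aeval μ (jacobiGen α β n) = (resolventSum (μ / 2) N (jacobiShiftedC α β n)).eval 0 := by
  rw [jacobiGen, resolventSum, map_sum, eval_finsetSum]
  rw [← Finset.sum_subset (Finset.range_mono (Nat.succ_le_succ hN))]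
  · refine Finset.sum_congr rfl fun k _ => ?_
    rw [eval_mul, eval_C, eval_zero_iterate_derivative, coeff_map, coeff_jacobiShifted,
      eval_one_iterate_derivative_jacobiPoly, map_mul, aeval_C, map_pow, aeval_X]
    simp only [Complex.coe_algebraMap]
    push_cast
    rw [show -(μ / 2) = (-1 / 2) * μ by ring, mul_pow]
    ring
  · intro k _ hk
    rw [eval_mul, eval_zero_iterate_derivative, coeff_map, coeff_jacobiShifted, jacobiCoeff,
      risingFactorial_neg_eq_zero (by simpa using hk)]
    simp

theorem resolventSum_add_C_mul (ν s : ℂ) (N : ℕ) (P Q : ℂ[X]) :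
    resolventSum ν N (P + C s * Q) = resolventSum ν N P + C s * resolventSum ν N Q := by
  rw [resolventSum, resolventSum, resolventSum, Finset.mul_sum, ← Finset.sum_add_distrib]
  refine Finset.sum_congr rfl fun k _ => ?_
  rw [iterate_map_add, iterate_derivative_C_mul]
  ring

theorem jacobiGen_add_mul_ne_zero {α β : ℝ} (h1 : -1 < α) (h2 : α < 1) (hβ : 0 < β) (m : ℕ)
    {μ s : ℂ} (hμ : μ ≠ 0) (hμ' : 0 ≤ μ.re)
    (hs : 0 ≤ (s / μ).re) :
    aeval μ (jacobiGen α β (m + 1)) + s * aeval μ (jacobiGen α β m) ≠ 0 := by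
  rw [aeval_jacobiGen α β le_rfl, aeval_jacobiGen α β m.le_succ]
  have h := resolventSum_eval_zero_ne_zero h1 h2 hβ m (ν := μ / 2) (s := s) (by simpa)
    (by rw [Complex.div_ofNat_re]; linarith) ?_
  · rwa [resolventSum_add_C_mul, eval_add, eval_mul, eval_C] at h
  · rw [div_div_eq_mul_div, mul_div_right_comm]
    simpa using hs

theorem jacobiGen_isHurwitz {α β : ℝ} (h1 : -1 < α) (h2 : α < 1) (hβ : 0 < β) (n : ℕ) :
    IsHurwitz (jacobiGen α β n) := by
  intro z hz
  have hd : 0 < (jacobiGen α β n).coeff 0 := by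
    rw [coeff_jacobiGen n.zero_le]
    exact eval_one_iterate_derivative_jacobiPoly_pos h1 (by linarith) n.zero_le
  rcases n with _ | m
  · rw [jacobiGen] at hd ⊢
    simpa using hd.ne'
  · by_cases h0 : z = 0
    · rw [h0, ← Complex.ofReal_zero, aeval_ofReal_complex, ← coeff_zero_eq_eval_zero]
      exact_mod_cast hd.ne'
    · simpa using jacobiGen_add_mul_ne_zero h1 h2 hβ m (s := 0) h0 hz (by simp)

/-- On the negative axis `ψ_{m+1} φ_m - φ_{m+1} ψ_m` is positive. -/
theorem jacobiPsi_mul_jacobiPhi_sub_pos {α β : ℝ} (h1 : -1 < α) (h2 : α < 1) (hβ : 0 < β)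
    (m : ℕ) {x : ℝ} (hx : x < 0) :
    0 < (jacobiPsi α β (m + 1)).eval x * (jacobiPhi α β m).eval x -
      (jacobiPhi α β (m + 1)).eval x * (jacobiPsi α β m).eval x := by
  have hw : -(√(-x)) ^ 2 = x := by rw [Real.sq_sqrt (by linarith)]; ring
  have hw0 : √(-x) ≠ 0 := (Real.sqrt_pos.2 (by linarith)).ne'
  set w := √(-x)
  set μ : ℂ := Complex.I * w with hμ
  have hre : μ.re = 0 := by simp [hμ]
  have hμ0 : μ ≠ 0 := mul_ne_zero Complex.I_ne_zero (by exact_mod_cast hw0)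
  have hne := jacobiGen_isHurwitz h1 h2 hβ m μ hre.ge
  have hre' : 0 < (aeval μ (jacobiGen α β (m + 1)) / (aeval μ (jacobiGen α β m) * μ)).re := by
    by_contra hcon
    -- This `s` makes `F_{m+1} + s F_m` vanish at `μ`, so `Re (s/μ) ≥ 0` is impossible.
    refine jacobiGen_add_mul_ne_zero h1 h2 hβ m (μ := μ)
      (s := -(aeval μ (jacobiGen α β (m + 1)) / aeval μ (jacobiGen α β m))) hμ0 hre.ge ?_ ?_
    · rw [neg_div, div_div, Complex.neg_re]
      linarith
    · field_simp
      ring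
  rw [Complex.div_re, ← add_div,
    div_pos_iff_of_pos_right (Complex.normSq_pos.2 (mul_ne_zero hne hμ0)), hμ,
    aeval_I_mul (jacobiGen_eq α β m), aeval_I_mul (jacobiGen_eq α β (m + 1)), hw] at hre'
  simp at hre'
  have hpos : 0 < w ^ 2 := by positivity
  refine pos_of_mul_pos_right (b := _) (a := w ^ 2) ?_ hpos.le
  linarith

theorem eval_zero_jacobiPhi_pos {α β : ℝ} (hα : -1 < α) (hαβ : -1 < α + β) (n : ℕ) :
    0 < (jacobiPhi α β n).eval 0 := by
  have h := eval_one_iterate_derivative_jacobiPoly_pos hα hαβ n.zero_le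
  rw [jacobiPhi, ← coeff_zero_eq_eval_zero, finsetSum_coeff]
  simpa [coeff_C_mul, coeff_X_pow] using h

theorem eval_zero_jacobiPsi_pos {α β : ℝ} (hα : -1 < α) (hαβ : -1 < α + β) {n : ℕ}
    (hn : 0 < n) : 0 < (jacobiPsi α β n).eval 0 := by
  have h := eval_one_iterate_derivative_jacobiPoly_pos (n := n) (k := 1) hα hαβ hn
  rw [jacobiPsi, ← coeff_zero_eq_eval_zero, finsetSum_coeff, Finset.sum_eq_single 0]
  · simpa using h
  · intro k _ hk
    simp [coeff_X_pow, hk.symm]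
  · intro hk
    simp at hk
    omega

theorem interlace_jacobiPhi {α β : ℝ} (h1 : -1 < α) (h2 : α < 1) (hβ : 0 < β) {m : ℕ} (hm : 0 < m) :
    Interlace (jacobiPhi α β (m + 1)) (jacobiPhi α β m) ∧
      Interlace (jacobiPhi α β (m + 1)) (X * jacobiPhi α β m) := by
  have hαβ : -1 < α + β := by linarith
  have H := jacobiGen_isHurwitz h1 h2 hβ
  have D := fun {n : ℕ} (hn : 0 < n) => natDegree_jacobiGen_pos h1 hαβ hn
  have E := fun n : ℕ => jacobiGen_eq α β n
  refine interlace_and_interlace_X_mul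
    (fun z hz => (H (m + 1)).even_zeros_neg (D m.succ_pos) (E _) hz)
    (fun z hz => (H m).even_zeros_neg (D hm) (E _) hz) ?_ ?_
    (mul_pos (eval_zero_jacobiPhi_pos h1 hαβ _) (eval_zero_jacobiPhi_pos h1 hαβ _))
  · intro x hx h0
    have a := (H (m + 1)).even_sign (D m.succ_pos) (E _) hx h0
    have b := jacobiPsi_mul_jacobiPhi_sub_pos h1 h2 hβ m hx
    rw [h0, zero_mul, sub_zero] at b
    -- Multiplying the Hermite–Biehler sign by the cross inequality produces the wanted product
    -- times the square of `ψ_{m+1}(x)`.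
    refine pos_of_mul_pos_right (a := (jacobiPsi α β (m + 1)).eval x ^ 2) ?_ (sq_nonneg _)
    linarith [mul_pos a b]
  · intro x hx h0
    have a := (H m).even_sign (D hm) (E _) hx h0
    have b := jacobiPsi_mul_jacobiPhi_sub_pos h1 h2 hβ m hx
    rw [h0, mul_zero, zero_sub] at b
    refine neg_of_mul_neg_right (a := (jacobiPsi α β m).eval x ^ 2) ?_ (sq_nonneg _)
    linarith [mul_pos a b]

theorem interlace_jacobiPsi {α β : ℝ} (h1 : -1 < α) (h2 : α < 1) (hβ : 0 < β) {m : ℕ} (hm : 0 < m) :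
    Interlace (jacobiPsi α β (m + 1)) (jacobiPsi α β m) ∧
      Interlace (jacobiPsi α β (m + 1)) (X * jacobiPsi α β m) := by
  have hαβ : -1 < α + β := by linarith
  have H := jacobiGen_isHurwitz h1 h2 hβ
  have D := fun {n : ℕ} (hn : 0 < n) => natDegree_jacobiGen_pos h1 hαβ hn
  have E := fun n : ℕ => jacobiGen_eq α β n
  have V := fun {n : ℕ} (hn : 0 < n) => eval_zero_jacobiPsi_pos h1 hαβ hn
  refine interlace_and_interlace_X_mul
    (fun z hz => (H (m + 1)).odd_zeros_neg (D m.succ_pos) (E _) (V m.succ_pos).ne' hz)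
    (fun z hz => (H m).odd_zeros_neg (D hm) (E _) (V hm).ne' hz) ?_ ?_
    (mul_pos (V hm) (V m.succ_pos))
  · intro x hx h0
    have a := (H (m + 1)).odd_sign (D m.succ_pos) (E _) hx h0
    have b := jacobiPsi_mul_jacobiPhi_sub_pos h1 h2 hβ m hx
    rw [h0, zero_mul, zero_sub] at b
    refine pos_of_mul_pos_right (a := (jacobiPhi α β (m + 1)).eval x ^ 2) ?_ (sq_nonneg _)
    linarith [mul_pos (neg_pos.2 a) b]
  · intro x hx h0
    have a := (H m).odd_sign (D hm) (E _) hx h0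
    have b := jacobiPsi_mul_jacobiPhi_sub_pos h1 h2 hβ m hx
    rw [h0, mul_zero, sub_zero] at b
    refine neg_of_mul_neg_right (a := (jacobiPhi α β m).eval x ^ 2) ?_ (sq_nonneg _)
    linarith [mul_pos (neg_pos.2 a) b]

/-! ### Parameter shift: from the odd parts to the range `1 ≤ α < 2`. -/

/-- The derivative of a Jacobi polynomial is a multiple of a Jacobi polynomial with both
parameters raised by one; stated for the derivatives at `1`. -/
theorem eval_one_iterate_derivative_jacobiPoly_succ {α : ℝ} (hα : 0 < α) (β : ℝ) (n k : ℕ) :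
    (derivative^[k + 1] (jacobiPoly (α - 1) (β - 1) (n + 1))).eval 1 =
      (n + α + β) / 2 * (derivative^[k] (jacobiPoly α β n)).eval 1 := by
  have h1 := (risingFactorial_pos (show 0 < α + 1 by linarith) k).ne'
  have h4 : (n.factorial : ℝ) ≠ 0 := by positivity
  have h3 : (k.factorial : ℝ) ≠ 0 := by positivity
  have h5 : (k + 1 : ℝ) ≠ 0 := by positivity
  have h6 : (n + 1 : ℝ) ≠ 0 := by positivity
  have e1 : (((n + 1 : ℕ) : ℝ) + (α - 1) + (β - 1) + 1) = n + α + β := by push_cast; ring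
  have e2 : -((n + 1 : ℕ) : ℝ) + 1 = -n := by push_cast; ring
  rw [eval_one_iterate_derivative_jacobiPoly, eval_one_iterate_derivative_jacobiPoly, jacobiCoeff,
    jacobiCoeff, e1, sub_add_cancel, risingFactorial_succ_left, risingFactorial_succ_left,
    risingFactorial_succ_left, risingFactorial_succ_left, e2, Nat.factorial_succ,
    Nat.factorial_succ, pow_succ]
  push_cast
  field_simp

/-- Odd-order derivatives of a Jacobi polynomial are even-order derivatives of its first derivative,
which is again Jacobi. This turns interlacing of the `ψ` into interlacing of the `φ` with both
parameters raised by one. -/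
theorem jacobiPsi_succ {α : ℝ} (hα : 0 < α) (β : ℝ) (n : ℕ) :
    jacobiPsi (α - 1) (β - 1) (n + 1) = C ((n + α + β) / 2) * jacobiPhi α β n := by
  rw [jacobiPsi, jacobiPhi, Finset.mul_sum, show (n + 1 + 1) / 2 = n / 2 + 1 by omega]
  refine Finset.sum_congr rfl fun k _ => ?_
  rw [eval_one_iterate_derivative_jacobiPoly_succ hα, C_mul, mul_assoc]

theorem HasSimpleRealZeros.of_C_mul {p : ℝ[X]} {c : ℝ}
    (h : HasSimpleRealZeros (C c * p)) : HasSimpleRealZeros p := by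
  intro z hz
  obtain ⟨him, hm⟩ := h z (by simp [hz])
  refine ⟨him, ?_⟩
  -- For the zero polynomial every point is a zero of `rootMultiplicity` `0`, not `1`; this also
  -- excludes `c = 0`.
  have hne : (C c * p).map (algebraMap ℝ ℂ) ≠ 0 := by
    intro h0
    rw [h0] at hm
    simp at hm
  rw [Polynomial.map_mul] at hm hne
  rw [rootMultiplicity_mul hne, map_C, rootMultiplicity_C, zero_add] at hm
  exact hm

theorem Interlace.of_C_mul {g h : ℝ[X]} {c d : ℝ} (hc : c ≠ 0) (hd : d ≠ 0)
    (H : Interlace (C c * g) (C d * h)) : Interlace g h where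
  left_zeros := H.left_zeros.of_C_mul
  right_zeros := H.right_zeros.of_C_mul
  no_common_zero z hg hh := H.no_common_zero z (by simp [hg]) (by simp [hh])
  between_left := by simpa [OneZeroBetweenConsecutive, hc, hd] using H.between_left
  between_right := by simpa [OneZeroBetweenConsecutive, hc, hd] using H.between_right

end

theorem corollary3 (α β : ℝ)
    (hαβ : (-1 < α ∧ α < 1 ∧ 0 < β) ∨ (1 ≤ α ∧ α < 2 ∧ 1 < β))
    (n : ℕ) (hn : 4 ≤ n) :
    Interlace (jacobiPhi α β n) (jacobiPhi α β (n - 1)) ∧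
      Interlace (jacobiPhi α β n) (X * jacobiPhi α β (n - 1)) := by
  obtain ⟨m, rfl⟩ : ∃ m, n = m + 1 := ⟨n - 1, by omega⟩
  rw [Nat.add_sub_cancel]
  rcases hαβ with ⟨h1, h2, hβ⟩ | ⟨h1, h2, hβ⟩
  · exact interlace_jacobiPhi h1 h2 hβ (by omega)
  -- The index rises by one: `φ_{m+1}` and `φ_m` correspond to `ψ_{m+2}` and `ψ_{m+1}` at `(α-1,
  -- β-1)`.
  · have H := interlace_jacobiPsi (α := α - 1) (β := β - 1) (by linarith) (by linarith)
      (by linarith) m.succ_pos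
    have hα : 0 < α := by linarith
    have hc : ∀ k : ℕ, ((k : ℝ) + α + β) / 2 ≠ 0 := fun k => by
      have : (0 : ℝ) ≤ k := k.cast_nonneg
      have : 0 < (k : ℝ) + α + β := by linarith
      positivity
    rw [Nat.succ_eq_add_one, jacobiPsi_succ hα, jacobiPsi_succ hα, mul_left_comm X] at H
    exact ⟨H.1.of_C_mul (hc _) (hc _), H.2.of_C_mul (hc _) (hc _)⟩
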